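/- Let $K$ be an oriented virtual link diagram with $n$ classical crossings and connected shadow, i.e. either every component of $K$ passes through at least one classical crossing and any two classical crossings are joined by a sequence of arcs of $K$ that begin and end at classical crossings and pass only through virtual crossings in between, or $K$ is a single closed curve without classical crossings. The arrow polynomial of $K$ is the Laurent polynomial in $a$ over $\mathbb Z[K_1,K_2,\dots]$ $$\langle K\rangle_A=\sum_S a^{\alpha(S)-\beta(S)}\,(-a^2-a^{-2})^{\gamma(S)-1}\prod_{c}K_{n(c)},\qquad K_0=1,$$ where $S$ runs over the Kauffman states of $K$, $\alpha(S)$ and $\beta(S)$ are the numbers of $A$- and $B$-smoothings in $S$, $\gamma(S)$ is the number of loops of $S$, the product is over these loops $c$, and $n(c)$ is the arrow number of $c$: every smoothing that does not respect the orientation of $K$ creates two cusps, two consecutive cusps of a loop cancel if their insides (acute angles) are on the same side of the loop, and $n(c)$ is half the number of cusps of $c$ that remain after reduction. The span of $\langle K\rangle_A$ is the difference between its highest and its lowest degree in $a$. The atom of $K$ is the closed surface $M$ obtained from the four-valent graph whose vertices are the classical crossings of $K$ and whose edges are the arcs of $K$ between them, by gluing in black and white $2$-cells: at each vertex the black cells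 follow the two pairs of adjacent edges joined by the $B$-smoothing, and the white cells follow the two pairs joined by the $A$-smoothing (for a single closed curve without classical crossings, one black and one white disc are glued to it). If $M$ is orientable and has genus $g$, then $$\operatorname{span}\langle K\rangle_A\le 4n-4g .$$ Moreover, whether or not $M$ is orientable, $\operatorname{span}\langle K\rangle_A\le 4n-2\,(2-\chi(M))$, where $\chi(M)$ is the Euler characteristic of $M$. -/

import Mathlib

open scoped LaurentPolynomial

noncomputable section

/-- An oriented virtual link diagram with set of classical crossings `C`, in combinatorial form
(its Gauss diagram). Rotate the plane near a classical crossing so that both strands point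
upwards. The crossing then has two incoming ends (lower left, lower right) and two outgoing ends
(upper left, upper right); an outgoing or incoming end is a pair `(c, s)` with `s = false` for left
and `s = true` for right. One strand runs from lower left to upper right, the other one from lower
right to upper left; the crossing is positive when the first one is the overcrossing strand, and
negative otherwise. Virtual crossings carry no data: they are only passed through by the arcs
joining the classical crossings, and every such datum is drawn in the plane by some diagram with
virtual crossings. -/
structure VirtualLinkDiagram (C : Type*) where
  /-- `true` for a positive crossing, `false` for a negative one. -/
  positive : C → Bool
  /-- The oriented arc which leaves at the outgoing end `x` arrives at the incoming end `arc x`. -/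
  arc : C × Bool ≃ C × Bool
  /-- The number of link components without classical crossings. -/
  freeLoops : ℕ

namespace VirtualLinkDiagram

variable {C : Type*} (D : VirtualLinkDiagram C)

/-- The shadow, as a graph: its vertices are the classical crossings and the components without
classical crossings; two crossings are adjacent when an arc (passing through virtual crossings
only) joins them. -/
def shadow : SimpleGraph (C ⊕ Fin D.freeLoops) :=
  SimpleGraph.fromRel fun x y =>
    ∃ (c c' : C) (s s' : Bool), x = Sum.inl c ∧ y = Sum.inl c' ∧ D.arc (c, s) = (c', s')

/-- The shadow is connected (in particular non-empty): either every component has a classical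
crossing and any two classical crossings are joined by a sequence of arcs, or the diagram is a
single closed curve without classical crossings. -/
def ConnectedShadow : Prop := D.shadow.Connected

/-- The ends at the classical crossings: `Sum.inl x` is the outgoing end `x`, and `Sum.inr x` is
the incoming end `x`. -/
abbrev End (C : Type*) : Type _ := (C × Bool) ⊕ (C × Bool)

/-- The other end of the arc that starts at a given end. -/
def acrossArc : End C → End C
  | Sum.inl x => Sum.inr (D.arc x)
  | Sum.inr x => Sum.inl (D.arc.symm x)

/-- A Kauffman state: `true` stands for the `A`-smoothing, `false` for the `B`-smoothing. -/
abbrev State (C : Type*) : Type _ := C → Bool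

/-- The smoothing of a crossing in a state is the oriented one (which joins the left ends, and the
right ends, along the orientation) if it is the `A`-smoothing of a positive crossing or the
`B`-smoothing of a negative one. Otherwise it is the disoriented one, which joins the two incoming
ends in a cusp and the two outgoing ends in another cusp. -/
def IsOrientedAt (S : State C) (c : C) : Bool := S c == D.positive c

/-- The end with which a given end is joined by the smoothing of its crossing. -/
def acrossSmoothing (S : State C) : End C → End C
  | Sum.inl (c, s) => if D.IsOrientedAt S c then Sum.inr (c, s) else Sum.inl (c, !s)
  | Sum.inr (c, s) => if D.IsOrientedAt S c then Sum.inl (c, s) else Sum.inr (c, !s)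

/-- Two ends lie on the same loop of the state. -/
def loopSetoid (S : State C) : Setoid (End C) :=
  Relation.EqvGen.setoid fun e f => f = D.acrossArc e ∨ f = D.acrossSmoothing S e

/-- The loops of a state that pass through classical crossings. -/
def Loop (S : State C) : Type _ := Quotient (D.loopSetoid S)

instance [Finite C] (S : State C) : Finite (D.Loop S) :=
  inferInstanceAs (Finite (Quotient (D.loopSetoid S)))

instance [Finite C] (S : State C) : Fintype (D.Loop S) := Fintype.ofFinite _

/-- The number `γ(S)` of all loops of a state. -/
def numLoops [Finite C] (S : State C) : ℕ := Fintype.card (D.Loop S) + D.freeLoops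

/-- The cusp met by a traveller on a loop of the state who arrives at a crossing through the given
end, if any: `true` if the inside of the cusp (its acute angle) is on the left of the traveller,
`false` if it is on the right. The inside of the cusp of the incoming ends lies below it, the inside
of the cusp of the outgoing ends lies above it. -/
def cuspAt (S : State C) : End C → Option Bool
  | Sum.inl (c, s) => if D.IsOrientedAt S c then none else some (!s)
  | Sum.inr (c, s) => if D.IsOrientedAt S c then none else some s

/-- A step of a traveller on a loop of the state: from the end through which he arrives at a
crossing to the end through which he arrives at the next one. -/
def step (S : State C) (e : End C) : End C := D.acrossArc (D.acrossSmoothing S e)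

/-- The cusps met on one tour of a loop, starting with arrival at the crossing of `e` through
`e`. -/
def cuspWord (S : State C) (e : End C) : List Bool :=
  (List.range (Function.minimalPeriod (D.step S) e)).filterMap fun i =>
    D.cuspAt S ((D.step S)^[i] e)

/-- The reduction of circle graphs with cusps: two consecutive cusps with insides on the same side
cancel, and a circle graph has no preferred starting point. -/
inductive CuspReduction : List Bool → List Bool → Prop
  | cancel (u v : List Bool) (b : Bool) : CuspReduction (u ++ b :: b :: v) (u ++ v)
  | rotate (u v : List Bool) : CuspReduction (u ++ v) (v ++ u)

/-- The number of cusps of the reduced circle graph of a loop. -/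
def reducedCusps (S : State C) (l : D.Loop S) : ℕ :=
  sInf {k | ∃ (e : End C) (w : List Bool), (Quotient.mk _ e : Quotient (D.loopSetoid S)) = l ∧
    Relation.ReflTransGen CuspReduction (D.cuspWord S e) w ∧ w.length = k}

/-- The arrow number of a loop: half the number of cusps of its reduced circle graph. -/
def arrowNumber (S : State C) (l : D.Loop S) : ℕ := D.reducedCusps S l / 2

/-- The ring `ℤ[K₁, K₂, …]`. -/
abbrev ArrowRing : Type := MvPolynomial ℕ+ ℤ

/-- The variable `Kₙ`, with `K₀ = 1`. -/
def arrowVar (n : ℕ) : ArrowRing := if h : 0 < n then MvPolynomial.X ⟨n, h⟩ else 1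

/-- The arrow polynomial, a Laurent polynomial in the variable `a` over `ℤ[K₁, K₂, …]`:
`∑ₛ a^(α(S) - β(S)) (-a² - a⁻²)^(γ(S) - 1) ∏ Kₙ`. -/
def arrowPolynomial [Fintype C] [DecidableEq C] : ArrowRing[T;T⁻¹] :=
  ∑ S : State C,
    LaurentPolynomial.T
        (((Finset.univ.filter fun c => S c = true).card : ℤ) -
          ((Finset.univ.filter fun c => S c = false).card : ℤ)) *
      (-LaurentPolynomial.T 2 - LaurentPolynomial.T (-2)) ^ (D.numLoops S - 1) *
      LaurentPolynomial.C (∏ l : D.Loop S, arrowVar (D.arrowNumber S l))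

/-- The difference between the leading and the lowest degree of a Laurent polynomial (`0` for the
zero polynomial). -/
def laurentSpan {R : Type*} [Semiring R] (p : R[T;T⁻¹]) : ℤ :=
  if h : p.coeff.support.Nonempty then p.coeff.support.max' h - p.coeff.support.min' h else 0

/-- The state in which all smoothings are `A`-smoothings. -/
def allA : State C := fun _ => true

/-- The state in which all smoothings are `B`-smoothings. -/
def allB : State C := fun _ => false

/-- The Euler characteristic of the atom of the diagram. The atom is the closed surface whose
vertices are the classical crossings, whose edges are the arcs between them, and whose cells are
glued to closed paths in this graph: at each crossing the black cells follow the pairs of adjacent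
edges that the `B`-smoothing joins, and the white cells follow those that the `A`-smoothing joins.
So the boundaries of the black and of the white cells are the loops of `allB` and of `allA`. A
component without classical crossings is a circle, with one black and one white cell glued in. -/
def atomEulerChar [Fintype C] : ℤ :=
  (Fintype.card C : ℤ) - (Fintype.card (C × Bool) : ℤ) + (D.numLoops allB : ℤ) +
    (D.numLoops allA : ℤ)

/-- The given directions at the ends (`true` for a boundary path pointing into the crossing,
`false` for one pointing out of it) come from orientations of the boundaries of the cells that are
glued in along the loops of the state `S`. -/
def IsCellOrientation (S : State C) (o : End C → Bool) : Prop :=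
  (∀ e, o (D.acrossArc e) = !o e) ∧ ∀ e, o (D.acrossSmoothing S e) = !o e

/-- The atom is orientable: its cells can be oriented so that the black and the white cell at each
edge induce opposite directions of this edge. -/
def AtomOrientable : Prop :=
  ∃ b w : End C → Bool, D.IsCellOrientation allB b ∧ D.IsCellOrientation allA w ∧ ∀ e, w e = !b e

/-- The atom (which is connected if the shadow is) is orientable of genus `g`. -/
def IsOrientedAtomGenus [Fintype C] (g : ℕ) : Prop :=
  D.AtomOrientable ∧ D.atomEulerChar = 2 - 2 * (g : ℤ)

end VirtualLinkDiagram

end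

/-! Write `α`, `β`, `γ` for the data of a state `S` and `n = α + β`. The term of `S` has exponents
between `α - β - 2(γ - 1)` and `α - β + 2(γ - 1)`; its arrow variables have degree `0` in `a`.
Changing one smoothing changes the number of loops by at most one (`numLoops_le_add_one`), so `γ ≤
γ_A + β` and `γ ≤ γ_B + α`, where `γ_A`, `γ_B` count the loops of the all-`A` and all-`B` states.
All exponents therefore lie between `-n - 2(γ_B - 1)` and `n + 2(γ_A - 1)`, and the span is at most
`2n + 2(γ_A + γ_B) - 4`. The loops of these two states bound the cells of the atom, so `χ = n - 2n +
γ_A + γ_B`, which gives the bound in `χ`; the orientable case is `χ = 2 - 2g`. -/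

namespace LaurentPolynomial

/-- The Laurent polynomials all of whose exponents lie in the interval from `lo` to `hi`. -/
def exponentsIn (R : Type*) [Ring R] (lo hi : ℤ) : AddSubgroup R[T;T⁻¹] where
  carrier := {p | ∀ k, p.coeff k ≠ 0 → lo ≤ k ∧ k ≤ hi}
  zero_mem' := by intro k hk; simp at hk
  add_mem' := by
    intro p q hp hq k hk
    by_cases h : p.coeff k = 0
    · exact hq k fun h' => hk (by simp [h, h'])
    · exact hp k h
  neg_mem' := by
    intro p hp k hk
    exact hp k fun h => hk (by simp [h])

variable {R : Type*} [Ring R] {lo hi lo' hi' : ℤ} {p q : R[T;T⁻¹]}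

theorem exponentsIn_mono (h₁ : lo' ≤ lo) (h₂ : hi ≤ hi') (hp : p ∈ exponentsIn R lo hi) :
    p ∈ exponentsIn R lo' hi' := fun k hk =>
  ⟨h₁.trans (hp k hk).1, (hp k hk).2.trans h₂⟩

theorem T_mem_exponentsIn (n : ℤ) : (T n : R[T;T⁻¹]) ∈ exponentsIn R n n := by
  intro k hk
  rw [T_apply] at hk
  have : n = k := by by_contra h; simp [h] at hk
  omega

theorem C_mem_exponentsIn (r : R) : C r ∈ exponentsIn R 0 0 := by
  intro k hk
  rw [C_apply] at hk
  have : k = 0 := by by_contra h; simp [h] at hk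
  omega

theorem mul_mem_exponentsIn (hp : p ∈ exponentsIn R lo hi) (hq : q ∈ exponentsIn R lo' hi') :
    p * q ∈ exponentsIn R (lo + lo') (hi + hi') := by
  intro k hk
  obtain ⟨i, h₁, j, h₂, rfl⟩ := Finset.mem_add.mp
    (AddMonoidAlgebra.support_coeff_mul_subset p q (Finsupp.mem_support_iff.mpr hk))
  have h₃ := hp i (Finsupp.mem_support_iff.mp h₁)
  have h₄ := hq j (Finsupp.mem_support_iff.mp h₂)
  omega

theorem pow_mem_exponentsIn (hp : p ∈ exponentsIn R lo hi) (n : ℕ) :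
    p ^ n ∈ exponentsIn R (n * lo) (n * hi) := by
  induction n with
  | zero => simpa using C_mem_exponentsIn (1 : R)
  | succ n ih =>
    have h (m : ℤ) : ((n + 1 : ℕ) : ℤ) * m = n * m + m := by push_cast; ring
    rw [pow_succ, h, h]
    exact mul_mem_exponentsIn ih hp

end LaurentPolynomial

namespace VirtualLinkDiagram

open LaurentPolynomial

/-- The condition `lo ≤ hi` serves the zero polynomial, whose span is `0` by convention. -/
theorem laurentSpan_le {R : Type*} [Ring R] {lo hi : ℤ} {p : R[T;T⁻¹]} (h : lo ≤ hi)
    (hp : p ∈ exponentsIn R lo hi) : laurentSpan p ≤ hi - lo := by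
  unfold laurentSpan
  split_ifs with hne
  · have h₁ := hp _ (Finsupp.mem_support_iff.mp (Finset.max'_mem _ hne))
    have h₂ := hp _ (Finsupp.mem_support_iff.mp (Finset.min'_mem _ hne))
    omega
  · omega

variable {C : Type*} (D : VirtualLinkDiagram C)

/-! ### Loops of a state under changes of smoothings -/

/-- The loop of a state that passes through a given end. -/
def loopOf (S : State C) (e : End C) : D.Loop S := Quotient.mk (D.loopSetoid S) e

theorem loopOf_surjective (S : State C) : Function.Surjective (D.loopOf S) :=
  Quotient.mk_surjective

theorem loopOf_acrossArc (S : State C) (e : End C) :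
    D.loopOf S (D.acrossArc e) = D.loopOf S e :=
  (Quotient.sound (s := D.loopSetoid S) (Relation.EqvGen.rel _ _ (Or.inl rfl))).symm

theorem loopOf_acrossSmoothing (S : State C) (e : End C) :
    D.loopOf S (D.acrossSmoothing S e) = D.loopOf S e :=
  (Quotient.sound (s := D.loopSetoid S) (Relation.EqvGen.rel _ _ (Or.inr rfl))).symm

/-- A function on the ends that is constant along arcs and smoothings descends to the loops. -/
def liftLoop {α : Type*} (S : State C) (f : End C → α) (h₁ : ∀ e, f (D.acrossArc e) = f e)
    (h₂ : ∀ e, f (D.acrossSmoothing S e) = f e) : D.Loop S → α :=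
  Quotient.lift f fun e e' h => by
    induction h with
    | rel x y h => rcases h with rfl | rfl <;> simp [h₁, h₂]
    | refl => rfl
    | symm _ _ _ ih => exact ih.symm
    | trans _ _ _ _ _ ih₁ ih₂ => exact ih₁.trans ih₂

/-- The crossing of an end. -/
def endCrossing : End C → C := Sum.elim Prod.fst Prod.fst

theorem endCrossing_acrossSmoothing (S : State C) (e : End C) :
    endCrossing (D.acrossSmoothing S e) = endCrossing e := by
  rcases e with ⟨c, s⟩ | ⟨c, s⟩ <;> simp only [acrossSmoothing] <;> split_ifs <;> rfl

theorem acrossSmoothing_congr {S S' : State C} {e : End C}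
    (h : S (endCrossing e) = S' (endCrossing e)) :
    D.acrossSmoothing S e = D.acrossSmoothing S' e := by
  rcases e with ⟨c, s⟩ | ⟨c, s⟩ <;>
    simp_all [acrossSmoothing, IsOrientedAt, endCrossing]

/-- At most two loops of a state pass through a given crossing. -/
theorem loopOf_eq_or_eq (S : State C) (e : End C) :
    D.loopOf S e = D.loopOf S (Sum.inl (endCrossing e, false)) ∨
      D.loopOf S e = D.loopOf S (Sum.inr (endCrossing e, true)) := by
  -- The two chosen ends are diagonally opposite, so neither smoothing joins them: they represent
  -- the two pairs of joined ends.
  have h := D.loopOf_acrossSmoothing S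
  rcases e with ⟨c, s⟩ | ⟨c, s⟩ <;> have h₁ := h (Sum.inl (c, false)) <;>
    have h₂ := h (Sum.inr (c, true)) <;> cases s <;>
    simp only [acrossSmoothing, endCrossing, Sum.elim_inl, Sum.elim_inr] at * <;>
    split_ifs at h₁ h₂ <;> simp_all

/-- Changing the smoothing of one crossing changes the number of loops by at most one. -/
theorem numLoops_le_add_one [Finite C] {S S' : State C} (a : C) (h : ∀ c, c ≠ a → S c = S' c) :
    D.numLoops S ≤ D.numLoops S' + 1 := by
  classical
  set x := D.loopOf S (Sum.inl (a, false)) with hx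
  set y := D.loopOf S (Sum.inr (a, true)) with hy
  -- Once the loops `x` and `y` of `S` through `a` are identified, the smoothing at `a` no longer
  -- matters, so the loops of `S'` map to the merged loops of `S`. Only `y` can be missed.
  let merge : D.Loop S → D.Loop S := fun l => if l = y then x else l
  have merge_eq (e : End C) (he : endCrossing e = a) : merge (D.loopOf S e) = x := by
    rcases D.loopOf_eq_or_eq S e with h' | h' <;> rw [he] at h' <;> simp only [merge, h', ← hx, ← hy]
    · split_ifs <;> rfl
    · simp
  let f : D.Loop S' → D.Loop S := D.liftLoop S' (fun e => merge (D.loopOf S e))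
    (fun e => by rw [loopOf_acrossArc]) fun e => by
      by_cases he : endCrossing e = a
      · rw [merge_eq e he, merge_eq _ (by rw [endCrossing_acrossSmoothing, he])]
      · rw [← D.acrossSmoothing_congr (h _ he), loopOf_acrossSmoothing]
  have hf : Finset.univ.erase y ⊆ Finset.univ.image f := by
    intro l hl
    obtain ⟨e, rfl⟩ := D.loopOf_surjective S l
    refine Finset.mem_image.mpr ⟨D.loopOf S' e, Finset.mem_univ _, ?_⟩
    exact if_neg (Finset.ne_of_mem_erase hl)
  have h₁ := (Finset.card_le_card hf).trans Finset.card_image_le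
  rw [Finset.card_erase_of_mem (Finset.mem_univ _), Finset.card_univ, Finset.card_univ] at h₁
  unfold numLoops
  omega

theorem numLoops_le_add_card [Finite C] (s : Finset C) {S S' : State C}
    (h : ∀ c, c ∉ s → S c = S' c) : D.numLoops S ≤ D.numLoops S' + s.card := by
  classical
  induction s using Finset.induction_on generalizing S' with
  | empty =>
    obtain rfl : S = S' := funext fun c => h c (Finset.notMem_empty c)
    simp
  | insert a s ha ih =>
    -- The intermediate state agrees with `S` outside `s` and with `S'` outside `a`.
    have h₁ : D.numLoops S ≤ D.numLoops (Function.update S' a (S a)) + s.card := ih fun c hc => by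
      by_cases hca : c = a
      · simp [hca]
      · rw [Function.update_of_ne hca]
        exact h c (by simp [hca, hc])
    have h₂ : D.numLoops (Function.update S' a (S a)) ≤ D.numLoops S' + 1 :=
      D.numLoops_le_add_one a fun c hc => Function.update_of_ne hc _ _
    rw [Finset.card_insert_of_notMem ha]
    omega

/-- Needed because `γ(S) - 1` in the state sum is a truncated subtraction. -/
theorem numLoops_pos [Finite C] (hD : D.ConnectedShadow) (S : State C) : 0 < D.numLoops S := by
  obtain ⟨c | i⟩ := hD.nonempty
  · have : 0 < Fintype.card (D.Loop S) := Fintype.card_pos_iff.mpr ⟨D.loopOf S (Sum.inl (c, true))⟩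
    unfold numLoops
    omega
  · have := i.pos
    unfold numLoops
    omega

/-! ### Bounds on the exponents and the span -/

theorem neg_T_sub_T_mem_exponentsIn {R : Type*} [Ring R] :
    (-T 2 - T (-2) : R[T;T⁻¹]) ∈ exponentsIn R (-2) 2 :=
  sub_mem (neg_mem (exponentsIn_mono (by norm_num) le_rfl (T_mem_exponentsIn 2)))
    (exponentsIn_mono le_rfl (by norm_num) (T_mem_exponentsIn (-2)))

theorem arrowPolynomial_mem_exponentsIn [Fintype C] [DecidableEq C] (hD : D.ConnectedShadow) :
    D.arrowPolynomial ∈ exponentsIn ArrowRing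
      (-(Fintype.card C : ℤ) - 2 * (D.numLoops allB - 1))
      (Fintype.card C + 2 * (D.numLoops allA - 1)) := by
  refine sum_mem fun S _ => ?_
  have hA : D.numLoops S ≤ D.numLoops allA + (Finset.univ.filter fun c => S c = false).card :=
    D.numLoops_le_add_card _ fun c hc => by simpa [allA] using hc
  have hB : D.numLoops S ≤ D.numLoops allB + (Finset.univ.filter fun c => S c = true).card :=
    D.numLoops_le_add_card _ fun c hc => by simpa [allB] using hc
  have hn : (Finset.univ.filter fun c => S c = true).card +
      (Finset.univ.filter fun c => S c = false).card = Fintype.card C := by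
    simpa using Finset.card_filter_add_card_filter_not (s := Finset.univ) (fun c => S c = true)
  have hS := D.numLoops_pos hD S
  -- At the top, `α - β + 2(γ - 1) ≤ α - β + 2(γ_A + β - 1) = n + 2(γ_A - 1)`; the bottom is
  -- symmetric, with `γ_B + α`.
  refine exponentsIn_mono ?_ ?_ (mul_mem_exponentsIn (mul_mem_exponentsIn (T_mem_exponentsIn _)
    (pow_mem_exponentsIn neg_T_sub_T_mem_exponentsIn _)) (C_mem_exponentsIn _)) <;> omega

theorem laurentSpan_arrowPolynomial_le [Fintype C] [DecidableEq C] (hD : D.ConnectedShadow) :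
    laurentSpan D.arrowPolynomial ≤ 4 * (Fintype.card C : ℤ) - 2 * (2 - D.atomEulerChar) := by
  have hA := D.numLoops_pos hD allA
  have hB := D.numLoops_pos hD allB
  refine (laurentSpan_le (by omega) (D.arrowPolynomial_mem_exponentsIn hD)).trans ?_
  rw [atomEulerChar, Fintype.card_prod, Fintype.card_bool]
  push_cast
  omega

end VirtualLinkDiagram

theorem theorem8 {C : Type*} [Fintype C] [DecidableEq C] (D : VirtualLinkDiagram C)
    (hD : D.ConnectedShadow) :
    (∀ g : ℕ, D.IsOrientedAtomGenus g →
      VirtualLinkDiagram.laurentSpan D.arrowPolynomial ≤ 4 * (Fintype.card C : ℤ) - 4 * (g : ℤ)) ∧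
    VirtualLinkDiagram.laurentSpan D.arrowPolynomial ≤
      4 * (Fintype.card C : ℤ) - 2 * (2 - D.atomEulerChar) := by
  have h := D.laurentSpan_arrowPolynomial_le hD
  refine ⟨fun g hg => ?_, h⟩
  rw [hg.2] at h
  linarith
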